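/- Let $M$ be a smooth $(n+2)$-dimensional manifold and let $\eta$ be a smooth $1$-form on $M$. For a pseudo-Riemannian metric $g$ (smooth, symmetric, non-degenerate) and a smooth affine connection $\nabla$ with torsion $T^\nabla$, call $(M,g,\eta,\nabla)$ a semi-Weyl manifold admitting torsion (SWMT) if $$(\nabla_X g)(Y,Z)+\eta(X)g(Y,Z)=(\nabla_Y g)(X,Z)+\eta(Y)g(X,Z)-g(T^\nabla(X,Y),Z)$$ for all smooth vector fields $X,Y,Z$. Two structures $(g,\nabla)$ and $(\widetilde g,\widetilde\nabla)$ are called conformal-projective equivalent if there are smooth functions $\phi,\psi$ with $$\widetilde g=e^{\phi+\psi}g,\qquad \widetilde\nabla_XY=\nabla_XY+d\phi(X)Y+d\phi(Y)X-g(X,Y)\,\mathrm{grad}_g\psi$$ for all smooth vector fields $X,Y$. Let $(M,g,\eta,\nabla)$ and $(M,\widetilde g,\eta,\widetilde\nabla)$ be SWMT that are conformal-projective equivalent. Let $M'$ be an (immersed) hypersurface of $M$ that is lightlike, i.e. the induced tensor $g'=g|_{TM'\times TM'}$ is degenerate at every point. Let $S(TM')\subset TM'$ be a screen distribution, i.e.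 a smooth subbundle complementary in $TM'$ to the radical $\mathrm{Rad}(TM')=\{\zeta: g'(\zeta,\cdot)=0\}$, and suppose that it is integrable (closed under the Lie bracket). Let $g',\widetilde g',\eta'$ denote the restrictions of $g,\widetilde g,\eta$ to $S(TM')$, and for sections $X,Y$ of $S(TM')$ let $\bar\nabla_XY$ (respectively $\bar{\widetilde\nabla}_XY$) be the component in $S(TM')$ of $\nabla_XY$ (respectively $\widetilde\nabla_XY$) with respect to the orthogonal decomposition $TM|_{M'}=S(TM')\oplus S(TM')^\perp$. Then $(g',\eta',\bar\nabla)$ and $(\widetilde g',\eta',\bar{\widetilde\nabla})$ are semi-Weyl structures with torsion on $S(TM')$: the restricted metrics are symmetric and non-degenerate on $S(TM')$, the torsion $\bar\nabla_XY-\bar\nabla_YX-[X,Y]$ is a section of $S(TM')$, and the semi-Weyl identity above holds for all smooth sections $X,Y,Z$ of $S(TM')$ (and likewise for the second structure). Moreover they are conformal-projective equivalent: there are smooth functions $\phi',\psi'$ on $M'$ with $$\widetilde g'=e^{\phi'+\psi'}g',\qquad \bar{\widetilde\nabla}_XY=\bar\nabla_XY+d\phi'(X)Y+d\phi'(Y)X-g'(X,Y)\,\bar\nabla\psi'$$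 for all smooth sections $X,Y$ of $S(TM')$, where $\bar\nabla\psi'$ is the section of $S(TM')$ determined by $g'(\bar\nabla\psi',Z)=Z(\psi')$ for all $Z$ in $S(TM')$. -/

import Mathlib

open Bundle Set Manifold VectorField
open scoped ContDiff Topology

noncomputable section

namespace SemiWeyl

set_option linter.unusedSectionVars false

section LinearAlgebra

variable {V : Type*} [AddCommGroup V] [Module ℝ V]

/-- The vector `u` representing the covector `α` with respect to the bilinear form `b`, that is
`b u z = α z` for all `z`. It exists and is unique when `b` is non-degenerate and `V` is
finite-dimensional, see `sharp_apply` and `sharp_unique`. -/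
def sharp (b : LinearMap.BilinForm ℝ V) (α : V →ₗ[ℝ] ℝ) : V :=
  Classical.epsilon fun u => ∀ z, b u z = α z

theorem sharp_apply [FiniteDimensional ℝ V] {b : LinearMap.BilinForm ℝ V}
    (hb : b.Nondegenerate) (α : V →ₗ[ℝ] ℝ) (z : V) : b (sharp b α) z = α z := by
  have h : ∃ u, ∀ z, b u z = α z :=
    ⟨(b.toDual hb).symm α, fun z => LinearMap.BilinForm.apply_toDual_symm_apply (hB := hb) α z⟩
  exact Classical.epsilon_spec h z

theorem sharp_unique [FiniteDimensional ℝ V] {b : LinearMap.BilinForm ℝ V}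
    (hb : b.Nondegenerate) (α : V →ₗ[ℝ] ℝ) {u : V} (hu : ∀ z, b u z = α z) : u = sharp b α := by
  rw [← sub_eq_zero]
  refine hb.1 _ fun z => ?_
  rw [map_sub, LinearMap.sub_apply, hu z, sharp_apply hb, sub_self]

end LinearAlgebra

section Ambient

variable {E : Type*} [NormedAddCommGroup E] [NormedSpace ℝ E] [FiniteDimensional ℝ E]
  {H : Type*} [TopologicalSpace H] (I : ModelWithCorners ℝ E H)
  (M : Type*) [TopologicalSpace M] [ChartedSpace H M] [IsManifold I ∞ M]

/-- A pseudo-Riemannian metric: a smooth symmetric non-degenerate `(0,2)`-tensor field. -/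
structure PseudoRiemannianMetric where
  /-- the scalar product on each tangent space -/
  inner (x : M) : TangentSpace I x →L[ℝ] TangentSpace I x →L[ℝ] ℝ
  symm (x : M) (v w : TangentSpace I x) : inner x v w = inner x w v
  nondegenerate (x : M) (v : TangentSpace I x) : (∀ w, inner x v w = 0) → v = 0
  contMDiff : ContMDiff I (I.prod 𝓘(ℝ, E →L[ℝ] E →L[ℝ] ℝ)) ∞
    (fun x => TotalSpace.mk' (E →L[ℝ] E →L[ℝ] ℝ) x (inner x))

/-- A smooth `1`-form. -/
structure OneForm where
  /-- the covector at each point -/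
  toFun (x : M) : TangentSpace I x →L[ℝ] ℝ
  contMDiff : ContMDiff I (I.prod 𝓘(ℝ, E →L[ℝ] ℝ)) ∞
    (fun x => TotalSpace.mk' (E →L[ℝ] ℝ) x (toFun x))

/-- Affine connections on `M` as operators on vector fields. `∇ Y x v` stands for `(∇_v Y)(x)`.
Smoothness of the connection is the class `ContMDiffCovariantDerivative ∇ ∞`. -/
abbrev AffineConnection := CovariantDerivative I E (TangentSpace I : M → Type _)

variable {I M}

/-- `X` is a smooth vector field. -/
def IsSmoothField (X : Π x : M, TangentSpace I x) : Prop :=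
  ContMDiff I I.tangent ∞ fun x => (⟨x, X x⟩ : TangentBundle I M)

/-- The metric at a point, as an algebraic bilinear form. -/
def PseudoRiemannianMetric.bilin (g : PseudoRiemannianMetric I M) (x : M) :
    LinearMap.BilinForm ℝ (TangentSpace I x) :=
  (ContinuousLinearMap.coeLM ℝ).comp (g.inner x : TangentSpace I x →ₗ[ℝ] _)

theorem PseudoRiemannianMetric.bilin_apply (g : PseudoRiemannianMetric I M) (x : M)
    (v w : TangentSpace I x) : g.bilin x v w = g.inner x v w := rfl

theorem PseudoRiemannianMetric.bilin_nondegenerate (g : PseudoRiemannianMetric I M) (x : M) :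
    (g.bilin x).Nondegenerate :=
  ⟨fun v hv => g.nondegenerate x v hv,
    fun v hv => g.nondegenerate x v fun w => by rw [g.symm]; exact hv w⟩

/-- The gradient of `ψ` with respect to `g`. -/
def gradient (g : PseudoRiemannianMetric I M) (ψ : M → ℝ) (x : M) : TangentSpace I x :=
  sharp (g.bilin x) (mvfderiv I ψ x : TangentSpace I x →ₗ[ℝ] ℝ)

/-- `(∇_X g)(Y, Z) = X (g(Y, Z)) - g(∇_X Y, Z) - g(Y, ∇_X Z)` at the point `x`. -/
def covDerivMetric (g : PseudoRiemannianMetric I M) (nabla : AffineConnection I M)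
    (X Y Z : Π x : M, TangentSpace I x) (x : M) : ℝ :=
  mvfderiv I (fun y => g.inner y (Y y) (Z y)) x (X x)
    - g.inner x (nabla Y x (X x)) (Z x) - g.inner x (Y x) (nabla Z x (X x))

/-- `(M, g, η, ∇)` is a semi-Weyl manifold admitting torsion. -/
def IsSWMT (g : PseudoRiemannianMetric I M) (η : OneForm I M) (nabla : AffineConnection I M) :
    Prop :=
  ∀ X Y Z : Π x : M, TangentSpace I x, IsSmoothField X → IsSmoothField Y → IsSmoothField Z →
    ∀ x : M,
      covDerivMetric g nabla X Y Z x + η.toFun x (X x) * g.inner x (Y x) (Z x) =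
        covDerivMetric g nabla Y X Z x + η.toFun x (Y x) * g.inner x (X x) (Z x)
          - g.inner x (nabla.torsion x (X x) (Y x)) (Z x)

/-- `(g₂, ∇₂)` is obtained from `(g₁, ∇₁)` by a conformal-projective transformation:
`g₂ = e^(φ + ψ) g₁` and `∇₂ = ∇₁ + dφ ⊗ I + I ⊗ dφ - g₁ ⊗ grad ψ`, for smooth functions `φ`, `ψ`,
the gradient being that of `g₁`. -/
def ConformalProjectiveEquivalent (g₁ : PseudoRiemannianMetric I M)
    (nabla₁ : AffineConnection I M) (g₂ : PseudoRiemannianMetric I M)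
    (nabla₂ : AffineConnection I M) : Prop :=
  ∃ φ ψ : M → ℝ, ContMDiff I 𝓘(ℝ, ℝ) ∞ φ ∧ ContMDiff I 𝓘(ℝ, ℝ) ∞ ψ ∧
    (∀ (x : M) (v w : TangentSpace I x),
      g₂.inner x v w = Real.exp (φ x + ψ x) * g₁.inner x v w) ∧
    ∀ X Y : Π x : M, TangentSpace I x, IsSmoothField X → IsSmoothField Y → ∀ x : M,
      nabla₂ Y x (X x) = nabla₁ Y x (X x) + mvfderiv I φ x (X x) • Y x
        + mvfderiv I φ x (Y x) • X x - g₁.inner x (X x) (Y x) • gradient g₁ ψ x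

end Ambient

section Distribution

variable {E : Type*} [NormedAddCommGroup E] [NormedSpace ℝ E] [FiniteDimensional ℝ E]
  {H : Type*} [TopologicalSpace H] {I : ModelWithCorners ℝ E H}
  {M : Type*} [TopologicalSpace M] [ChartedSpace H M] [IsManifold I ∞ M]

/-- A field of subspaces `S p ⊆ T_p M` is a smooth distribution (a smooth subbundle of the tangent
bundle): around every point it has a smooth local frame. -/
def IsSmoothDistribution (S : Π p : M, Submodule ℝ (TangentSpace I p)) : Prop :=
  ∀ p : M, ∃ U ∈ 𝓝 p, ∃ (k : ℕ) (s : Fin k → Π q : M, TangentSpace I q),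
    (∀ i, ContMDiffOn I I.tangent ∞ (fun q => (⟨q, s i q⟩ : TangentBundle I M)) U) ∧
    ∀ q ∈ U, LinearIndependent ℝ (fun i => s i q) ∧ Submodule.span ℝ (range fun i => s i q) = S q

/-- `X` is a smooth section of the distribution `S`. -/
def IsSmoothSection {S : Π p : M, Submodule ℝ (TangentSpace I p)} (X : Π p, S p) : Prop :=
  IsSmoothField fun p => (X p : TangentSpace I p)

/-- `S` is integrable: the Lie bracket of two smooth sections of `S` is a section of `S`. -/
def IsIntegrable (S : Π p : M, Submodule ℝ (TangentSpace I p)) : Prop :=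
  ∀ X Y : Π p, S p, IsSmoothSection X → IsSmoothSection Y →
    ∀ p, mlieBracket I (fun q => (X q : TangentSpace I q)) (fun q => (Y q : TangentSpace I q)) p ∈
      S p

/-- The triple `(h, θ, D)`, of a bilinear form `h` and a `1`-form `θ` on the distribution `S` and a
covariant derivative `D X Y = D_X Y` of sections of `S` along `S`, is semi-Weyl with torsion on `S`:
`h` is symmetric and non-degenerate, the torsion `T(X, Y) = D_X Y - D_Y X - [X, Y]` of `D` is a
section of `S`, and
`(D_X h)(Y, Z) + θ(X) h(Y, Z) = (D_Y h)(X, Z) + θ(Y) h(X, Z) - h(T(X, Y), Z)`. -/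
def IsSWMTOn (S : Π p : M, Submodule ℝ (TangentSpace I p))
    (h : Π p, LinearMap.BilinForm ℝ (S p)) (θ : Π p, S p →ₗ[ℝ] ℝ)
    (D : (Π p, S p) → (Π p, S p) → Π p, S p) : Prop :=
  (∀ p, (∀ u v, h p u v = h p v u) ∧ (h p).Nondegenerate) ∧
  ∀ X Y Z : Π p, S p, IsSmoothSection X → IsSmoothSection Y → IsSmoothSection Z → ∀ p : M,
    ∃ T : S p,
      (T : TangentSpace I p) = D X Y p - D Y X p -
        mlieBracket I (fun q => (X q : TangentSpace I q)) (fun q => (Y q : TangentSpace I q)) p ∧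
      (mvfderiv I (fun q => h q (Y q) (Z q)) p (X p) - h p (D X Y p) (Z p) - h p (Y p) (D X Z p))
          + θ p (X p) * h p (Y p) (Z p) =
        (mvfderiv I (fun q => h q (X q) (Z q)) p (Y p) - h p (D Y X p) (Z p) - h p (X p) (D Y Z p))
          + θ p (Y p) * h p (X p) (Z p) - h p T (Z p)

/-- The conformal-projective relation for structures `(h₁, D₁)`, `(h₂, D₂)` on the distribution `S`:
`h₂ = e^(φ + ψ) h₁` and `D₂ = D₁ + dφ ⊗ I + I ⊗ dφ - h₁ ⊗ grad ψ` for smooth functions `φ`, `ψ`,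
where `grad ψ` is the section of `S` with `h₁(grad ψ, Z) = Z(ψ)` for all `Z` in `S`. -/
def ConformalProjectiveEquivalentOn (S : Π p : M, Submodule ℝ (TangentSpace I p))
    (h₁ : Π p, LinearMap.BilinForm ℝ (S p)) (D₁ : (Π p, S p) → (Π p, S p) → Π p, S p)
    (h₂ : Π p, LinearMap.BilinForm ℝ (S p)) (D₂ : (Π p, S p) → (Π p, S p) → Π p, S p) : Prop :=
  ∃ φ ψ : M → ℝ, ContMDiff I 𝓘(ℝ, ℝ) ∞ φ ∧ ContMDiff I 𝓘(ℝ, ℝ) ∞ ψ ∧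
    (∀ (p : M) (u v : S p), h₂ p u v = Real.exp (φ p + ψ p) * h₁ p u v) ∧
    ∀ X Y : Π p, S p, IsSmoothSection X → IsSmoothSection Y → ∀ p : M,
      D₂ X Y p = D₁ X Y p + mvfderiv I φ p (X p) • Y p + mvfderiv I φ p (Y p) • X p
        - h₁ p (X p) (Y p) •
          sharp (h₁ p) ((mvfderiv I ψ p : TangentSpace I p →ₗ[ℝ] ℝ).comp (S p).subtype)

end Distribution

section Hypersurface

variable {E : Type*} [NormedAddCommGroup E] [NormedSpace ℝ E] [FiniteDimensional ℝ E]
  {H : Type*} [TopologicalSpace H] {I : ModelWithCorners ℝ E H}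
  {M : Type*} [TopologicalSpace M] [ChartedSpace H M] [IsManifold I ∞ M]
  {E' : Type*} [NormedAddCommGroup E'] [NormedSpace ℝ E'] [FiniteDimensional ℝ E']
  {H' : Type*} [TopologicalSpace H'] {I' : ModelWithCorners ℝ E' H'}
  {M' : Type*} [TopologicalSpace M'] [ChartedSpace H' M'] [IsManifold I' ∞ M']

/-- The differential of `ι` at `p`, as an algebraic linear map. -/
def differential (I : ModelWithCorners ℝ E H) (I' : ModelWithCorners ℝ E' H') (ι : M' → M)
    (p : M') : TangentSpace I' p →ₗ[ℝ] TangentSpace I (ι p) :=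
  (mfderiv I' I ι p : TangentSpace I' p →ₗ[ℝ] TangentSpace I (ι p))

/-- The induced tensor `g' = ι^* g` on `M'`. -/
def inducedForm (g : PseudoRiemannianMetric I M) (I' : ModelWithCorners ℝ E' H') (ι : M' → M)
    (p : M') : LinearMap.BilinForm ℝ (TangentSpace I' p) :=
  (g.bilin (ι p)).compl₁₂ (differential I I' ι p) (differential I I' ι p)

/-- The fibre at `p` of the radical distribution of `g' = ι^* g`. -/
def radical (g : PseudoRiemannianMetric I M) (I' : ModelWithCorners ℝ E' H') (ι : M' → M)
    (p : M') : Submodule ℝ (TangentSpace I' p) :=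
  LinearMap.ker (inducedForm g I' ι p)

/-- `ι` immerses `M'` in `(M, g)` as a lightlike submanifold: the induced tensor `g'` is degenerate
at every point of `M'`. -/
def IsLightlike (g : PseudoRiemannianMetric I M) (I' : ModelWithCorners ℝ E' H') (ι : M' → M) :
    Prop :=
  IsImmersion I' I ∞ ι ∧
    ∀ p : M', ∃ ζ : TangentSpace I' p, ζ ≠ 0 ∧ ∀ v, inducedForm g I' ι p ζ v = 0

/-- `S` is a screen distribution: a smooth distribution complementary to the radical one. -/
def IsScreenDistribution (g : PseudoRiemannianMetric I M) (ι : M' → M)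
    (S : Π p : M', Submodule ℝ (TangentSpace I' p)) : Prop :=
  IsSmoothDistribution S ∧ ∀ p, IsCompl (S p) (radical g I' ι p)

/-- The metric `g'` restricted to `S`. -/
def screenMetric (g : PseudoRiemannianMetric I M) (ι : M' → M)
    (S : Π p : M', Submodule ℝ (TangentSpace I' p)) (p : M') : LinearMap.BilinForm ℝ (S p) :=
  (inducedForm g I' ι p).restrict (S p)

/-- The induced `1`-form `η' = ι^* η`, restricted to `S`. -/
def screenOneForm (η : OneForm I M) (ι : M' → M)
    (S : Π p : M', Submodule ℝ (TangentSpace I' p)) (p : M') : S p →ₗ[ℝ] ℝ :=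
  ((η.toFun (ι p) : TangentSpace I (ι p) →ₗ[ℝ] ℝ).comp (differential I I' ι p)).comp
    (S p).subtype

/-- The component in `S` of a vector `w ∈ T_(ι p) M`, with respect to the orthogonal decomposition
`TM|_M' = S ⊕ S^⊥`: the vector `u` of `S p` with `g(dι u, dι z) = g(w, dι z)` for all `z` in `S p`,
see `screenPart_orthogonal`. -/
def screenPart (g : PseudoRiemannianMetric I M) (ι : M' → M)
    (S : Π p : M', Submodule ℝ (TangentSpace I' p)) (p : M') (w : TangentSpace I (ι p)) : S p :=
  sharp (screenMetric g ι S p)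
    (((g.bilin (ι p) w).comp (differential I I' ι p)).comp (S p).subtype)

/-- The connection induced by `∇` on vector fields along `ι` (the pull-back connection).
For `Y` a vector field along `ι` and `v ∈ T_p M'`, write `Y q = F(q)` in the local trivialization of
`TM` around `ι p`. Then `∇_v Y` is the vector with coordinates `dF(v)`, plus `∇_(dι v)` of the local
field with constant coordinates `F(p)`. See `covDerivAlong_restrict` for the restriction to `M'`
of a vector field on `M`. -/
def covDerivAlong (nabla : AffineConnection I M) (I' : ModelWithCorners ℝ E' H') (ι : M' → M)
    (Y : Π q : M', TangentSpace I (ι q)) (p : M') (v : TangentSpace I' p) :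
    TangentSpace I (ι p) :=
  (trivializationAt E (TangentSpace I : M → Type _) (ι p)).symmL ℝ (ι p)
      (mvfderiv I' (fun q => (trivializationAt E (TangentSpace I : M → Type _) (ι p)
        (⟨ι q, Y q⟩ : TangentBundle I M)).2) p v)
    + nabla (FiberBundle.extend E (Y p)) (ι p) (differential I I' ι p v)

/-- The induced connection on `S`: `∇̄_X Y` is the component in `S` of `∇_X Y`. -/
def screenConnection (g : PseudoRiemannianMetric I M) (nabla : AffineConnection I M) (ι : M' → M)
    (S : Π p : M', Submodule ℝ (TangentSpace I' p)) (X Y : Π p, S p) (p : M') : S p :=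
  screenPart g ι S p
    (covDerivAlong nabla I' ι (fun q => differential I I' ι q (Y q)) p (X p))

theorem inducedForm_apply (g : PseudoRiemannianMetric I M) (ι : M' → M) (p : M')
    (v w : TangentSpace I' p) : inducedForm g I' ι p v w =
      g.inner (ι p) (mfderiv I' I ι p v) (mfderiv I' I ι p w) := rfl

theorem screenMetric_nondegenerate {g : PseudoRiemannianMetric I M} {ι : M' → M}
    {S : Π p : M', Submodule ℝ (TangentSpace I' p)} (hS : IsScreenDistribution g ι S) (p : M') :
    (screenMetric g ι S p).Nondegenerate := by
  have hsymm : ∀ v w, inducedForm g I' ι p v w = inducedForm g I' ι p w v :=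
    fun v w => g.symm _ _ _
  have key : ∀ u : S p, (∀ z : S p, screenMetric g ι S p u z = 0) → u = 0 := by
    intro u hu
    have hmem : (u : TangentSpace I' p) ∈ radical g I' ι p := by
      refine LinearMap.ext fun w => ?_
      have hw : w ∈ S p ⊔ radical g I' ι p := by rw [(hS.2 p).sup_eq_top]; trivial
      obtain ⟨a, ha, b, hb, rfl⟩ := Submodule.mem_sup.1 hw
      have h1 : inducedForm g I' ι p u a = 0 := hu ⟨a, ha⟩
      have h2 : inducedForm g I' ι p b u = 0 := LinearMap.congr_fun (LinearMap.mem_ker.1 hb) _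
      rw [map_add, h1, hsymm, h2, add_zero, LinearMap.zero_apply]
    have := (Submodule.disjoint_def.1 (hS.2 p).disjoint) u u.2 hmem
    exact Subtype.ext this
  exact ⟨key, fun u hu => key u fun z => (hsymm _ _).trans (hu z)⟩

theorem screenPart_orthogonal {g : PseudoRiemannianMetric I M} {ι : M' → M}
    {S : Π p : M', Submodule ℝ (TangentSpace I' p)} (hS : IsScreenDistribution g ι S) (p : M')
    (w : TangentSpace I (ι p)) (z : S p) :
    g.inner (ι p) (w - mfderiv I' I ι p (screenPart g ι S p w)) (mfderiv I' I ι p z) = 0 := by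
  have : FiniteDimensional ℝ (TangentSpace I' p) := inferInstanceAs (FiniteDimensional ℝ E')
  have h := sharp_apply (screenMetric_nondegenerate hS p)
    (((g.bilin (ι p) w).comp (differential I I' ι p)).comp (S p).subtype) z
  rw [map_sub, sub_apply, sub_eq_zero]
  exact h.symm

theorem covDerivAlong_restrict (nabla : AffineConnection I M) {ι : M' → M}
    {p : M'} (hι : MDifferentiableAt I' I ι p) {Y : Π x : M, TangentSpace I x}
    (hY : MDifferentiableAt I I.tangent (fun x => (⟨x, Y x⟩ : TangentBundle I M)) (ι p))
    (v : TangentSpace I' p) :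
    covDerivAlong nabla I' ι (fun q => Y (ι q)) p v = nabla Y (ι p) (mfderiv I' I ι p v) := by
  let e := trivializationAt E (TangentSpace I : M → Type _) (ι p)
  have hmem : ι p ∈ e.baseSet := FiberBundle.mem_baseSet_trivializationAt' (ι p)
  let c : (Π x : M, TangentSpace I x) → M → E := fun Z x => (e (⟨x, Z x⟩ : TangentBundle I M)).2
  have hc : ∀ Z : Π x : M, TangentSpace I x,
      MDifferentiableAt I I.tangent (fun x => (⟨x, Z x⟩ : TangentBundle I M)) (ι p) →
      MDifferentiableAt I 𝓘(ℝ, E) (c Z) (ι p) := fun Z hZ =>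
    (mdifferentiableAt_section I Z).1 hZ
  have hlin : ∀ x ∈ e.baseSet, ∀ w : TangentSpace I x,
      (e (⟨x, w⟩ : TangentBundle I M)).2 = e.continuousLinearMapAt ℝ x w := fun x hx w => by
    rw [Trivialization.continuousLinearMapAt_apply, e.coe_linearMapAt_of_mem hx]
  have hbase : e.baseSet ∈ 𝓝 (ι p) := e.open_baseSet.mem_nhds hmem
  have hsymm : ∀ w : TangentSpace I (ι p),
      e.symmL ℝ (ι p) (e (⟨ι p, w⟩ : TangentBundle I M)).2 = w := by
    intro w
    rw [hlin _ hmem, e.symmL_continuousLinearMapAt hmem]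
  let u := mfderiv I' I ι p v
  let Φ : (Π x : M, TangentSpace I x) → TangentSpace I (ι p) := fun Z =>
    nabla Z (ι p) u - e.symmL ℝ (ι p) (mvfderiv I (c Z) (ι p) u)
  have hΦ : TensorialAt I E Φ (ι p) := by
    constructor
    · intro f Z hf hZ
      have h1 : c (f • Z) =ᶠ[𝓝 (ι p)] f • c Z := by
        filter_upwards [hbase] with x hx
        simp only [c, hlin x hx, Pi.smul_apply', map_smul]
      have h2 := nabla.isCovariantDerivativeOnUniv.leibniz hZ hf
      have h3 : mvfderiv I (c (f • Z)) (ι p) = mvfderiv I (f • c Z) (ι p) := by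
        unfold mvfderiv; rw [h1.mfderiv_eq]; rfl
      simp only [Φ, h2, h3, mvfderiv_smul hf (hc Z hZ)]
      simp [hsymm, c]
      module
    · intro Z Z' hZ hZ'
      have h1 : c (Z + Z') =ᶠ[𝓝 (ι p)] c Z + c Z' := by
        filter_upwards [hbase] with x hx
        simp only [c, hlin x hx, Pi.add_apply, map_add]
      have h2 := nabla.isCovariantDerivativeOnUniv.add hZ hZ'
      have h3 : mvfderiv I (c (Z + Z')) (ι p) = mvfderiv I (c Z + c Z') (ι p) := by
        unfold mvfderiv; rw [h1.mfderiv_eq]; rfl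
      simp only [Φ, h2, h3, mvfderiv_add (hc Z hZ) (hc Z' hZ')]
      simp
      module
  have hext := FiberBundle.mdifferentiableAt_extend I E (Y (ι p))
  have h0 : mvfderiv I (c (FiberBundle.extend E (Y (ι p)))) (ι p) = 0 := by
    have h1 : c (FiberBundle.extend E (Y (ι p))) =ᶠ[𝓝 (ι p)] fun _ => c Y (ι p) := by
      filter_upwards [hbase] with x hx
      have h := e.apply_mk_symm hx (c Y (ι p))
      exact (Prod.ext_iff.1 h).2
    have h3 : mvfderiv I (c (FiberBundle.extend E (Y (ι p)))) (ι p)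
        = mvfderiv I (fun _ : M => c Y (ι p)) (ι p) := by
      unfold mvfderiv; rw [h1.mfderiv_eq]; rfl
    rw [h3, mvfderiv_const]
  have hpt := hΦ.pointwise hY hext (by simp)
  have hchain : mvfderiv I' (fun q => c Y (ι q)) p v = mvfderiv I (c Y) (ι p) u :=
    mfderiv_comp_apply p (hc Y hY) hι v
  simp only [Φ, h0] at hpt
  have hgoal : covDerivAlong nabla I' ι (fun q => Y (ι q)) p v =
      e.symmL ℝ (ι p) (mvfderiv I' (fun q => c Y (ι q)) p v)
        + nabla (FiberBundle.extend E (Y (ι p))) (ι p) u := rfl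
  rw [hgoal, hchain]
  simp only [zero_apply, map_zero, sub_zero] at hpt
  rw [← hpt]
  exact add_sub_cancel _ _

end Hypersurface

end SemiWeyl

end

open SemiWeyl

noncomputable section

namespace SemiWeyl

set_option linter.unusedSectionVars false

section Bracket

variable {E : Type*} [NormedAddCommGroup E] [NormedSpace ℝ E] [FiniteDimensional ℝ E]
  {H : Type*} [TopologicalSpace H] {I : ModelWithCorners ℝ E H}
  {M : Type*} [TopologicalSpace M] [ChartedSpace H M] [IsManifold I ∞ M]
  {F : Type*} [NormedAddCommGroup F] [NormedSpace ℝ F]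

theorem mvfderiv_congr {f f' : M → F} {p : M} (h : f =ᶠ[𝓝 p] f') :
    mvfderiv I f p = mvfderiv I f' p := by
  unfold mvfderiv
  rw [h.mfderiv_eq]
  rfl

/-- The chain rule for `K ∘ φ`, where `K` is a map between vector spaces. -/
theorem mvfderiv_comp_fderiv {E₀ : Type*} [NormedAddCommGroup E₀] [NormedSpace ℝ E₀]
    {K : E₀ → F} {φ : M → E₀} {p : M} (hK : DifferentiableAt ℝ K (φ p))
    (hφ : MDifferentiableAt I 𝓘(ℝ, E₀) φ p) (v : TangentSpace I p) :
    mvfderiv I (fun q => K (φ q)) p v = fderiv ℝ K (φ p) (mvfderiv I φ p v) := by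
  have h := mfderiv_comp_apply p hK.mdifferentiableAt hφ v
  rw [mfderiv_eq_fderiv] at h
  exact h

/-- The derivative of a function in terms of its expression in a chart. -/
theorem mvfderiv_eq_fderiv_chart {f : M → F} {p₀ p : M} (hp : p ∈ (chartAt H p₀).source)
    (hf : DifferentiableAt ℝ (fun z => f ((extChartAt I p₀).symm z)) (extChartAt I p₀ p))
    (v : TangentSpace I p) :
    mvfderiv I f p v = fderiv ℝ (fun z => f ((extChartAt I p₀).symm z)) (extChartAt I p₀ p)
      (mvfderiv I (extChartAt I p₀) p v) := by
  rw [← mvfderiv_comp_fderiv (K := fun z => f ((extChartAt I p₀).symm z)) hf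
    (mdifferentiableAt_extChartAt hp)]
  refine congrArg (fun L : TangentSpace I p →L[ℝ] F => L v) (mvfderiv_congr ?_)
  filter_upwards [(chartAt H p₀).open_source.mem_nhds hp] with q hq
  rw [(extChartAt I p₀).left_inv (by rwa [extChartAt_source])]

variable [I.Boundaryless]

/-- The derivation along `[X, Y]` is the commutator of the derivations along `X` and `Y`. -/
theorem mvfderiv_mlieBracket {f : M → F} {X Y : Π p : M, TangentSpace I p} {p : M}
    (hf : ContMDiffAt I 𝓘(ℝ, F) ∞ f p)
    (hX : MDifferentiableAt I I.tangent (fun q => (⟨q, X q⟩ : TangentBundle I M)) p)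
    (hY : MDifferentiableAt I I.tangent (fun q => (⟨q, Y q⟩ : TangentBundle I M)) p) :
    mvfderiv I f p (mlieBracket I X Y p) =
      mvfderiv I (fun q => mvfderiv I f q (Y q)) p (X p)
        - mvfderiv I (fun q => mvfderiv I f q (X q)) p (Y p) := by
  have h2 : (2 : WithTop ℕ∞) ≤ ∞ := WithTop.coe_le_coe.2 le_top
  have : IsManifold I 2 M := .of_le (n := ∞) h2
  set φ := extChartAt I p with hφ
  have hp : p ∈ (chartAt H p).source := mem_chart_source H p
  let f' : E → F := fun z => f (φ.symm z)
  let V (Z : Π p : M, TangentSpace I p) : E → E :=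
    mpullbackWithin 𝓘(ℝ, E) I φ.symm Z (range I)
  have hsymm : ContMDiffAt 𝓘(ℝ, E) I ∞ φ.symm (φ p) := by
    have := contMDiffWithinAt_extChartAt_symm_range (I := I) (n := ∞) p (mem_extChartAt_target p)
    rwa [I.range_eq_univ, contMDiffWithinAt_univ] at this
  have hf' : ContDiffAt ℝ ∞ f' (φ p) := by
    refine ContMDiffAt.contDiffAt (ContMDiffAt.comp (φ p) ?_ hsymm)
    rwa [hφ, extChartAt_to_inv]
  have hV (Z : Π p : M, TangentSpace I p)
      (hZ : MDifferentiableAt I I.tangent (fun q => (⟨q, Z q⟩ : TangentBundle I M)) p) :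
      DifferentiableAt ℝ (V Z) (φ p) := by
    have : DifferentiableWithinAt ℝ (V Z) (φ.symm ⁻¹' univ ∩ range I) (φ p) :=
      (mdifferentiableWithinAt_univ.2 hZ).differentiableWithinAt_mpullbackWithin_vectorField
    rwa [preimage_univ, univ_inter, I.range_eq_univ, differentiableWithinAt_univ] at this
  have hVφ (Z : Π p : M, TangentSpace I p) : ∀ q ∈ (chartAt H p).source,
      V Z (φ q) = mvfderiv I φ q (Z q) := by
    intro q hq
    have hq' : q ∈ φ.source := by rwa [hφ, extChartAt_source]
    have hinv : V Z (φ q) = mvfderiv I φ (φ.symm (φ q)) (Z (φ.symm (φ q))) := by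
      have h : (mfderivWithin 𝓘(ℝ, E) I φ.symm (range I) (φ q)).inverse =
          mfderiv I 𝓘(ℝ, E) φ (φ.symm (φ q)) :=
        ContinuousLinearMap.inverse_eq
          (mfderivWithin_extChartAt_symm_comp_mfderiv_extChartAt (φ.map_source hq'))
          (mfderiv_extChartAt_comp_mfderivWithin_extChartAt_symm (φ.map_source hq'))
      exact congrArg (fun L : TangentSpace I (φ.symm (φ q)) →L[ℝ] E => L (Z (φ.symm (φ q)))) h
    rwa [φ.left_inv hq'] at hinv
  have hk (Z : Π p : M, TangentSpace I p)
      (hZ : MDifferentiableAt I I.tangent (fun q => (⟨q, Z q⟩ : TangentBundle I M)) p)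
      (v : TangentSpace I p) :
      mvfderiv I (fun q => mvfderiv I f q (Z q)) p v =
        fderiv ℝ (fun z => fderiv ℝ f' z (V Z z)) (φ p) (mvfderiv I φ p v) := by
    have hd : ∀ᶠ z in 𝓝 (φ p), DifferentiableAt ℝ f' z :=
      ((hf'.of_le (m := 1) (by simp)).eventually (by simp)).mono
        fun z hz => hz.differentiableAt (by simp)
    have hc : ContinuousAt φ p := continuousAt_extChartAt p
    rw [← mvfderiv_comp_fderiv (K := fun z => fderiv ℝ f' z (V Z z)) _
      (mdifferentiableAt_extChartAt hp)]
    · refine congrArg (fun L : TangentSpace I p →L[ℝ] F => L v) (mvfderiv_congr ?_)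
      filter_upwards [(chartAt H p).open_source.mem_nhds hp, hc.eventually hd] with q hq hdq
      rw [mvfderiv_eq_fderiv_chart hq hdq, hVφ Z q hq]
    · exact ((hf'.fderiv_right (m := 1) h2).differentiableAt (by simp)).clm_apply (hV Z hZ)
  rw [hk Y hY, hk X hX, ← hVφ X p hp, ← hVφ Y p hp,
    ← fderiv_apply_lieBracket hf' (by simpa using h2) (hV Y hY) (hV X hX),
    mvfderiv_eq_fderiv_chart hp (hf'.differentiableAt (by simp))]
  congr 1
  have hinv := isInvertible_mfderiv_extChartAt (I := I) (mem_extChartAt_source (I := I) p)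
  have h : mvfderiv I φ p (mlieBracket I X Y p) =
      lieBracketWithin ℝ (V X) (V Y) (φ.symm ⁻¹' univ ∩ range I) (φ p) :=
    (hinv.inverse_apply_eq.1 rfl).symm
  rw [h, preimage_univ, univ_inter, I.range_eq_univ, lieBracketWithin_univ]

end Bracket

section Coordinates

variable {E : Type*} [NormedAddCommGroup E] [NormedSpace ℝ E] [FiniteDimensional ℝ E]
  {H : Type*} [TopologicalSpace H] {I : ModelWithCorners ℝ E H}
  {M : Type*} [TopologicalSpace M] [ChartedSpace H M] [IsManifold I ∞ M]

/-- The product rule for the values of a bilinear map. -/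
theorem mvfderiv_bilinear {F₁ F₂ F₃ : Type*} [NormedAddCommGroup F₁] [NormedSpace ℝ F₁]
    [NormedAddCommGroup F₂] [NormedSpace ℝ F₂] [NormedAddCommGroup F₃] [NormedSpace ℝ F₃]
    (B : F₁ →L[ℝ] F₂ →L[ℝ] F₃) {a : M → F₁} {b : M → F₂} {p : M}
    (ha : MDifferentiableAt I 𝓘(ℝ, F₁) a p) (hb : MDifferentiableAt I 𝓘(ℝ, F₂) b p)
    (v : TangentSpace I p) :
    mvfderiv I (fun q => B (a q) (b q)) p v =
      B (mvfderiv I a p v) (b p) + B (a p) (mvfderiv I b p v) := by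
  have hφ : MDifferentiableAt I 𝓘(ℝ, F₁ × F₂) (fun q => (a q, b q)) p := ha.prodMk_space hb
  have h₁ : mvfderiv I a p v = (mvfderiv I (fun q => (a q, b q)) p v).1 := by
    have h := mvfderiv_comp_fderiv (K := Prod.fst) differentiableAt_fst hφ v
    rwa [fderiv_fst] at h
  have h₂ : mvfderiv I b p v = (mvfderiv I (fun q => (a q, b q)) p v).2 := by
    have h := mvfderiv_comp_fderiv (K := Prod.snd) differentiableAt_snd hφ v
    rwa [fderiv_snd] at h
  have hB := B.hasFDerivAt_of_bilinear (hasFDerivAt_fst (𝕜 := ℝ) (p := (a p, b p)))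
    (hasFDerivAt_snd (𝕜 := ℝ) (p := (a p, b p)))
  have h := mvfderiv_comp_fderiv (φ := fun q => (a q, b q)) hB.differentiableAt hφ v
  rw [hB.fderiv] at h
  rw [h₁, h₂, add_comm]
  exact h

/-- The product rule for the values of a varying linear map. -/
theorem mvfderiv_clm_apply {F₁ F₂ : Type*} [NormedAddCommGroup F₁] [NormedSpace ℝ F₁]
    [NormedAddCommGroup F₂] [NormedSpace ℝ F₂]
    {A : M → F₁ →L[ℝ] F₂} {a : M → F₁} {p : M}
    (hA : MDifferentiableAt I 𝓘(ℝ, F₁ →L[ℝ] F₂) A p) (ha : MDifferentiableAt I 𝓘(ℝ, F₁) a p)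
    (v : TangentSpace I p) :
    mvfderiv I (fun q => A q (a q)) p v =
      mvfderiv I A p v (a p) + A p (mvfderiv I a p v) :=
  mvfderiv_bilinear (ContinuousLinearMap.id ℝ (F₁ →L[ℝ] F₂)) hA ha v

/-- The product rule for the values of a varying bilinear form. -/
theorem mvfderiv_clm_apply₂ {F : Type*} [NormedAddCommGroup F] [NormedSpace ℝ F]
    {A : M → F →L[ℝ] F →L[ℝ] ℝ} {a b : M → F} {p : M}
    (hA : MDifferentiableAt I 𝓘(ℝ, F →L[ℝ] F →L[ℝ] ℝ) A p)
    (ha : MDifferentiableAt I 𝓘(ℝ, F) a p) (hb : MDifferentiableAt I 𝓘(ℝ, F) b p)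
    (v : TangentSpace I p) :
    mvfderiv I (fun q => A q (a q) (b q)) p v = mvfderiv I A p v (a p) (b p)
      + A p (mvfderiv I a p v) (b p) + A p (a p) (mvfderiv I b p v) := by
  rw [mvfderiv_clm_apply (A := fun q => A q (a q)) (hA.clm_apply ha) hb,
    mvfderiv_clm_apply hA ha, add_apply]

/-- The metric in the trivialization of the tangent bundle around `x₀`. -/
theorem PseudoRiemannianMetric.exists_coordinates (g : PseudoRiemannianMetric I M) (x₀ : M) :
    ∃ G : M → E →L[ℝ] E →L[ℝ] ℝ, MDifferentiableAt I 𝓘(ℝ, E →L[ℝ] E →L[ℝ] ℝ) G x₀ ∧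
      ∀ x ∈ (trivializationAt E (TangentSpace I : M → Type _) x₀).baseSet, ∀ a b : E,
        G x a b = g.inner x
          ((trivializationAt E (TangentSpace I : M → Type _) x₀).symmL ℝ x a)
          ((trivializationAt E (TangentSpace I : M → Type _) x₀).symmL ℝ x b) := by
  have h := (contMDiffAt_hom_bundle _).1 (g.contMDiff x₀)
  refine ⟨_, h.2.mdifferentiableAt (by simp), fun x hx a b => ?_⟩
  refine (inCoordinates_apply_eq₂ (F₃ := ℝ) (E₃ := Bundle.Trivial M ℝ) hx hx (mem_univ x)).trans ?_
  simp only [Trivial.fiberBundle_trivializationAt', Trivial.linearMapAt_trivialization,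
    LinearMap.id_apply, Trivialization.symmL_apply, hx]

/-- A tangent vector extends to a smooth vector field, with constant coordinates near its base
point. -/
theorem exists_isSmoothField_eventuallyEq_extend [T2Space M] {x : M} (v : TangentSpace I x) :
    ∃ X : Π y : M, TangentSpace I y, IsSmoothField X ∧
      ∀ᶠ y in 𝓝 x, X y = FiberBundle.extend E v y := by
  obtain ⟨s, hs, hsm⟩ := FiberBundle.exists_contMDiffOn_extend (k := ∞) I E v
  obtain ⟨u, hus, hu, hxu⟩ := mem_nhds_iff.1 hs
  obtain ⟨f, hf, -⟩ := (SmoothBumpFunction.nhds_basis_support (I := I) (c := x)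
    (hu.mem_nhds hxu)).mem_iff.1 (hu.mem_nhds hxu)
  refine ⟨fun y => f y • FiberBundle.extend E v y,
    ContMDiffOn.smul_section_of_tsupport f.contMDiff.contMDiffOn hu hf (hsm.mono hus), ?_⟩
  filter_upwards [f.eventuallyEq_one] with y hy
  rw [hy, Pi.one_apply, one_smul]

end Coordinates

section Pointwise

variable {E : Type*} [NormedAddCommGroup E] [NormedSpace ℝ E] [FiniteDimensional ℝ E]
  {H : Type*} [TopologicalSpace H] {I : ModelWithCorners ℝ E H}
  {M : Type*} [TopologicalSpace M] [ChartedSpace H M] [IsManifold I ∞ M]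

theorem IsSmoothField.mdifferentiableAt {X : Π x : M, TangentSpace I x} (hX : IsSmoothField X)
    (x : M) : MDifferentiableAt I I.tangent (fun y => (⟨y, X y⟩ : TangentBundle I M)) x :=
  ContMDiff.mdifferentiable hX (by simp) x

theorem covDeriv_congr (nabla : AffineConnection I M) {x : M} {Y Y' : Π x : M, TangentSpace I x}
    (hY : MDifferentiableAt I I.tangent (fun y => (⟨y, Y y⟩ : TangentBundle I M)) x)
    (h : ∀ᶠ y in 𝓝 x, Y y = Y' y) : nabla Y x = nabla Y' x := by
  refine nabla.isCovariantDerivativeOnUniv.congr_of_eventuallyEq hY ?_ Filter.univ_mem h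
  refine hY.congr_of_eventuallyEq ?_
  filter_upwards [h] with y hy
  rw [hy]

theorem covDerivMetric_congr (g : PseudoRiemannianMetric I M) (nabla : AffineConnection I M)
    {x : M} {X X' Y Y' Z Z' : Π x : M, TangentSpace I x}
    (hY : MDifferentiableAt I I.tangent (fun y => (⟨y, Y y⟩ : TangentBundle I M)) x)
    (hZ : MDifferentiableAt I I.tangent (fun y => (⟨y, Z y⟩ : TangentBundle I M)) x)
    (hXX' : X x = X' x) (hYY' : ∀ᶠ y in 𝓝 x, Y y = Y' y) (hZZ' : ∀ᶠ y in 𝓝 x, Z y = Z' y) :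
    covDerivMetric g nabla X Y Z x = covDerivMetric g nabla X' Y' Z' x := by
  have h : (fun y => g.inner y (Y y) (Z y)) =ᶠ[𝓝 x] fun y => g.inner y (Y' y) (Z' y) := by
    filter_upwards [hYY', hZZ'] with y h₁ h₂
    rw [h₁, h₂]
  unfold covDerivMetric
  rw [mvfderiv_congr h, covDeriv_congr nabla hY hYY', covDeriv_congr nabla hZ hZZ', hXX',
    hYY'.self_of_nhds, hZZ'.self_of_nhds]

/-- The semi-Weyl identity for tangent vectors, in terms of their local extensions. -/
theorem IsSWMT.extend [T2Space M] {g : PseudoRiemannianMetric I M} {η : OneForm I M}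
    {nabla : AffineConnection I M} (h : IsSWMT g η nabla) (x : M) (u v w : TangentSpace I x) :
    covDerivMetric g nabla (FiberBundle.extend E u) (FiberBundle.extend E v)
        (FiberBundle.extend E w) x + η.toFun x u * g.inner x v w =
      covDerivMetric g nabla (FiberBundle.extend E v) (FiberBundle.extend E u)
        (FiberBundle.extend E w) x + η.toFun x v * g.inner x u w
        - g.inner x (nabla.torsion x u v) w := by
  obtain ⟨X, hX, hXu⟩ := exists_isSmoothField_eventuallyEq_extend u
  obtain ⟨Y, hY, hYv⟩ := exists_isSmoothField_eventuallyEq_extend v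
  obtain ⟨Z, hZ, hZw⟩ := exists_isSmoothField_eventuallyEq_extend w
  have hXYZ := h X Y Z hX hY hZ x
  rw [covDerivMetric_congr g nabla (hY.mdifferentiableAt x) (hZ.mdifferentiableAt x)
      hXu.self_of_nhds hYv hZw,
    covDerivMetric_congr g nabla (hX.mdifferentiableAt x) (hZ.mdifferentiableAt x)
      hYv.self_of_nhds hXu hZw, hXu.self_of_nhds, hYv.self_of_nhds, hZw.self_of_nhds] at hXYZ
  simpa only [FiberBundle.extend_apply_self] using hXYZ

/-- The conformal-projective relation of two connections for tangent vectors, in terms of their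
local extensions. -/
theorem covDeriv_extend_of_conformalProjective [T2Space M] {g : PseudoRiemannianMetric I M}
    {nabla nabla₂ : AffineConnection I M} {φ ψ : M → ℝ}
    (h : ∀ X Y : Π x : M, TangentSpace I x, IsSmoothField X → IsSmoothField Y → ∀ x : M,
      nabla₂ Y x (X x) = nabla Y x (X x) + mvfderiv I φ x (X x) • Y x
        + mvfderiv I φ x (Y x) • X x - g.inner x (X x) (Y x) • gradient g ψ x)
    (x : M) (u v : TangentSpace I x) :
    nabla₂ (FiberBundle.extend E v) x u = nabla (FiberBundle.extend E v) x u
      + mvfderiv I φ x u • v + mvfderiv I φ x v • u - g.inner x u v • gradient g ψ x := by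
  obtain ⟨X, hX, hXu⟩ := exists_isSmoothField_eventuallyEq_extend u
  obtain ⟨Y, hY, hYv⟩ := exists_isSmoothField_eventuallyEq_extend v
  have hXY := h X Y hX hY x
  rw [covDeriv_congr nabla (hY.mdifferentiableAt x) hYv,
    covDeriv_congr nabla₂ (hY.mdifferentiableAt x) hYv, hXu.self_of_nhds,
    hYv.self_of_nhds] at hXY
  simpa only [FiberBundle.extend_apply_self] using hXY

end Pointwise

section Along

variable {E : Type*} [NormedAddCommGroup E] [NormedSpace ℝ E] [FiniteDimensional ℝ E]
  {H : Type*} [TopologicalSpace H] {I : ModelWithCorners ℝ E H}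
  {M : Type*} [TopologicalSpace M] [ChartedSpace H M] [IsManifold I ∞ M]
  {E' : Type*} [NormedAddCommGroup E'] [NormedSpace ℝ E'] [FiniteDimensional ℝ E']
  {H' : Type*} [TopologicalSpace H'] {I' : ModelWithCorners ℝ E' H'}
  {M' : Type*} [TopologicalSpace M'] [ChartedSpace H' M'] [IsManifold I' ∞ M']

/-- The derivative of the metric along `ι` is that of the metric of `M`. -/
theorem covDerivMetric_along (g : PseudoRiemannianMetric I M) (nabla : AffineConnection I M)
    {ι : M' → M} {p : M'} (hι : MDifferentiableAt I' I ι p) {Y Z : Π q : M', TangentSpace I (ι q)}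
    (hY : MDifferentiableAt I' I.tangent (fun q => (⟨ι q, Y q⟩ : TangentBundle I M)) p)
    (hZ : MDifferentiableAt I' I.tangent (fun q => (⟨ι q, Z q⟩ : TangentBundle I M)) p)
    (v : TangentSpace I' p) :
    mvfderiv I' (fun q => g.inner (ι q) (Y q) (Z q)) p v
      - g.inner (ι p) (covDerivAlong nabla I' ι Y p v) (Z p)
      - g.inner (ι p) (Y p) (covDerivAlong nabla I' ι Z p v) =
    covDerivMetric g nabla (FiberBundle.extend E (differential I I' ι p v))
      (FiberBundle.extend E (Y p)) (FiberBundle.extend E (Z p)) (ι p) := by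
  let e := trivializationAt E (TangentSpace I : M → Type _) (ι p)
  have hmem : ι p ∈ e.baseSet := FiberBundle.mem_baseSet_trivializationAt' (ι p)
  have hbase : e.baseSet ∈ 𝓝 (ι p) := e.open_baseSet.mem_nhds hmem
  obtain ⟨G, hG, hGg⟩ := g.exists_coordinates (ι p)
  let c : (Π q : M', TangentSpace I (ι q)) → M' → E :=
    fun Y q => (e (⟨ι q, Y q⟩ : TangentBundle I M)).2
  have hc (Y : Π q : M', TangentSpace I (ι q))
      (hY : MDifferentiableAt I' I.tangent (fun q => (⟨ι q, Y q⟩ : TangentBundle I M)) p) :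
      MDifferentiableAt I' 𝓘(ℝ, E) (c Y) p :=
    ((mdifferentiableAt_totalSpace I _).1 hY).2
  have hsymm : ∀ q, ι q ∈ e.baseSet → ∀ Y : Π q : M', TangentSpace I (ι q),
      e.symmL ℝ (ι q) (c Y q) = Y q := by
    intro q hq Y
    have h : c Y q = e.continuousLinearMapAt ℝ (ι q) (Y q) := by
      rw [Trivialization.continuousLinearMapAt_apply, e.coe_linearMapAt_of_mem hq]
    rw [h, e.symmL_continuousLinearMapAt hq]
  have h₁ : (fun q => g.inner (ι q) (Y q) (Z q)) =ᶠ[𝓝 p]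
      fun q => G (ι q) (c Y q) (c Z q) := by
    filter_upwards [hι.continuousAt hbase] with q hq
    rw [hGg _ hq, hsymm q hq, hsymm q hq]
  have h₂ : (fun y => g.inner y (FiberBundle.extend E (Y p) y) (FiberBundle.extend E (Z p) y))
      =ᶠ[𝓝 (ι p)] fun y => G y (c Y p) (c Z p) := by
    filter_upwards [hbase] with y hy
    rw [hGg _ hy, Trivialization.symmL_apply _ hy, Trivialization.symmL_apply _ hy]
    rfl
  have h₃ : mvfderiv I' (fun q => G (ι q)) p v = mvfderiv I G (ι p) (differential I I' ι p v) :=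
    mfderiv_comp_apply p hG hι v
  unfold covDerivMetric
  rw [mvfderiv_congr h₁, mvfderiv_congr h₂,
    mvfderiv_clm_apply₂ (A := fun q => G (ι q)) (hG.comp p hι) (hc Y hY) (hc Z hZ),
    mvfderiv_clm_apply₂ (A := G) hG mdifferentiableAt_const mdifferentiableAt_const, h₃,
    mvfderiv_const, mvfderiv_const, hGg _ hmem, hGg _ hmem, hsymm p hmem, hsymm p hmem]
  simp only [covDerivAlong, FiberBundle.extend_apply_self, map_add, add_apply, map_zero,
    zero_apply]
  simp only [c, e]
  ring

end Along

section Torsion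

variable {E : Type*} [NormedAddCommGroup E] [NormedSpace ℝ E] [FiniteDimensional ℝ E]
  {H : Type*} [TopologicalSpace H] {I : ModelWithCorners ℝ E H}
  {M : Type*} [TopologicalSpace M] [ChartedSpace H M] [IsManifold I ∞ M]
  {E' : Type*} [NormedAddCommGroup E'] [NormedSpace ℝ E'] [FiniteDimensional ℝ E']
  {H' : Type*} [TopologicalSpace H'] {I' : ModelWithCorners ℝ E' H'}
  {M' : Type*} [TopologicalSpace M'] [ChartedSpace H' M'] [IsManifold I' ∞ M']

/-- The trivialization of the tangent bundle around `x₀` is the derivative of the chart. -/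
theorem trivializationAt_snd_eq_mvfderiv {x₀ x : M} (hx : x ∈ (chartAt H x₀).source)
    (w : TangentSpace I x) :
    (trivializationAt E (TangentSpace I : M → Type _) x₀ (⟨x, w⟩ : TangentBundle I M)).2 =
      mvfderiv I (extChartAt I x₀) x w := by
  have hx' : x ∈ (trivializationAt E (TangentSpace I : M → Type _) x₀).baseSet := hx
  have h := congrArg (fun L : TangentSpace I x →L[ℝ] E => L w)
    (TangentBundle.continuousLinearMapAt_trivializationAt (I := I) hx)
  refine Eq.trans ?_ h
  rw [Trivialization.continuousLinearMapAt_apply, Trivialization.coe_linearMapAt_of_mem _ hx']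

theorem mlieBracket_extend [I.Boundaryless] {x : M} (u v : TangentSpace I x) :
    mlieBracket I (FiberBundle.extend E u) (FiberBundle.extend E v) x = 0 := by
  have hx : x ∈ (chartAt H x).source := mem_chart_source H x
  have hconst (w : TangentSpace I x) (z : TangentSpace I x) :
      mvfderiv I (fun y => mvfderiv I (extChartAt I x) y (FiberBundle.extend E w y)) x z = 0 := by
    have h : (fun y => mvfderiv I (extChartAt I x) y (FiberBundle.extend E w y)) =ᶠ[𝓝 x]
        fun _ => (trivializationAt E (TangentSpace I : M → Type _) x
          (⟨x, w⟩ : TangentBundle I M)).2 := by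
      filter_upwards [(chartAt H x).open_source.mem_nhds hx] with y hy
      rw [← trivializationAt_snd_eq_mvfderiv hy]
      have h := (trivializationAt E (TangentSpace I : M → Type _) x).apply_mk_symm hy
        (trivializationAt E (TangentSpace I : M → Type _) x (⟨x, w⟩ : TangentBundle I M)).2
      exact (Prod.ext_iff.1 h).2
    rw [mvfderiv_congr h, mvfderiv_const]
    rfl
  have h := mvfderiv_mlieBracket (contMDiffAt_extChartAt (I := I) (n := ∞) (x := x))
    (FiberBundle.mdifferentiableAt_extend I E u) (FiberBundle.mdifferentiableAt_extend I E v)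
  rw [hconst, hconst, sub_zero] at h
  exact (isInvertible_mfderiv_extChartAt (I := I) (mem_extChartAt_source (I := I) x)).injective
    (h.trans (map_zero (mvfderiv I (extChartAt I x) x)).symm)

theorem mdifferentiableAt_differential {ι : M' → M} (hι : ContMDiff I' I ∞ ι)
    {Y : Π q : M', TangentSpace I' q} (hY : IsSmoothField Y) (p : M') :
    MDifferentiableAt I' I.tangent
      (fun q => (⟨ι q, differential I I' ι q (Y q)⟩ : TangentBundle I M)) p := by
  have h : ContMDiff I'.tangent I.tangent ∞ (tangentMap I' I ι) :=
    hι.contMDiff_tangentMap (by simp)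
  exact (h.comp hY).mdifferentiable (by simp) p

/-- The torsion of the connection along `ι` is that of the connection of `M`. -/
theorem covDerivAlong_sub_covDerivAlong [I.Boundaryless] [I'.Boundaryless]
    (nabla : AffineConnection I M) {ι : M' → M} (hι : ContMDiff I' I ∞ ι)
    {X Y : Π q : M', TangentSpace I' q} (hX : IsSmoothField X) (hY : IsSmoothField Y) (p : M') :
    covDerivAlong nabla I' ι (fun q => differential I I' ι q (Y q)) p (X p)
      - covDerivAlong nabla I' ι (fun q => differential I I' ι q (X q)) p (Y p) =
    nabla.torsion (ι p) (differential I I' ι p (X p)) (differential I I' ι p (Y p))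
      + differential I I' ι p (mlieBracket I' X Y p) := by
  let e := trivializationAt E (TangentSpace I : M → Type _) (ι p)
  have hmem : ι p ∈ (chartAt H (ι p)).source := mem_chart_source H (ι p)
  have hnhds : ∀ᶠ q in 𝓝 p, ι q ∈ (chartAt H (ι p)).source :=
    hι.continuous.continuousAt ((chartAt H (ι p)).open_source.mem_nhds hmem)
  let f : M' → E := fun q => extChartAt I (ι p) (ι q)
  have hf : ContMDiffAt I' 𝓘(ℝ, E) ∞ f p := contMDiffAt_extChartAt.comp p (hι p)
  have hdf : ∀ q, ι q ∈ (chartAt H (ι p)).source → ∀ w : TangentSpace I' q,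
      (e (⟨ι q, differential I I' ι q w⟩ : TangentBundle I M)).2 = mvfderiv I' f q w := by
    intro q hq w
    refine (trivializationAt_snd_eq_mvfderiv hq _).trans ?_
    exact (mfderiv_comp_apply q (mdifferentiableAt_extChartAt hq)
      (hι.mdifferentiable (by simp) q) w).symm
  have hc (Z : Π q : M', TangentSpace I' q) :
      mvfderiv I' (fun q => (e (⟨ι q, differential I I' ι q (Z q)⟩ : TangentBundle I M)).2) p =
        mvfderiv I' (fun q => mvfderiv I' f q (Z q)) p := by
    refine mvfderiv_congr ?_
    filter_upwards [hnhds] with q hq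
    exact hdf q hq (Z q)
  have hsymm (w : TangentSpace I (ι p)) :
      e.symmL ℝ (ι p) (e (⟨ι p, w⟩ : TangentBundle I M)).2 = w := by
    have hmem' : ι p ∈ e.baseSet := hmem
    have h : (e (⟨ι p, w⟩ : TangentBundle I M)).2 = e.continuousLinearMapAt ℝ (ι p) w := by
      rw [Trivialization.continuousLinearMapAt_apply, e.coe_linearMapAt_of_mem hmem']
    rw [h, e.symmL_continuousLinearMapAt hmem']
  have hT := nabla.torsion_apply_eq_extend (differential I I' ι p (X p))
    (differential I I' ι p (Y p))
  rw [mlieBracket_extend, sub_zero] at hT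
  have hb := mvfderiv_mlieBracket hf (hX.mdifferentiableAt p) (hY.mdifferentiableAt p)
  rw [← hdf p hmem, ← hc X, ← hc Y] at hb
  rw [hT, ← hsymm (differential I I' ι p (mlieBracket I' X Y p)), hb, map_sub]
  simp only [covDerivAlong, FiberBundle.extend_apply_self, e]
  abel

end Torsion

section Screen

variable {E : Type*} [NormedAddCommGroup E] [NormedSpace ℝ E] [FiniteDimensional ℝ E]
  {H : Type*} [TopologicalSpace H] {I : ModelWithCorners ℝ E H}
  {M : Type*} [TopologicalSpace M] [ChartedSpace H M] [IsManifold I ∞ M]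
  {E' : Type*} [NormedAddCommGroup E'] [NormedSpace ℝ E'] [FiniteDimensional ℝ E']
  {H' : Type*} [TopologicalSpace H'] {I' : ModelWithCorners ℝ E' H'}
  {M' : Type*} [TopologicalSpace M'] [ChartedSpace H' M'] [IsManifold I' ∞ M']
  {g g₂ : PseudoRiemannianMetric I M} {ι : M' → M}
  {S : Π p : M', Submodule ℝ (TangentSpace I' p)}

theorem screenMetric_apply (p : M') (u v : S p) : screenMetric g ι S p u v =
    g.inner (ι p) (differential I I' ι p u) (differential I I' ι p v) := rfl

theorem screenMetric_symm (p : M') (u v : S p) :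
    screenMetric g ι S p u v = screenMetric g ι S p v u := g.symm _ _ _

theorem screenMetric_screenPart (hS : IsScreenDistribution g ι S) (p : M')
    (w : TangentSpace I (ι p)) (z : S p) :
    screenMetric g ι S p (screenPart g ι S p w) z =
      g.inner (ι p) w (differential I I' ι p z) := by
  have : FiniteDimensional ℝ (TangentSpace I' p) := inferInstanceAs (FiniteDimensional ℝ E')
  exact sharp_apply (screenMetric_nondegenerate hS p) _ z

theorem eq_screenPart (hS : IsScreenDistribution g ι S) (p : M') {w : TangentSpace I (ι p)}
    {u : S p} (h : ∀ z : S p, screenMetric g ι S p u z =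
      g.inner (ι p) w (differential I I' ι p z)) : u = screenPart g ι S p w := by
  have : FiniteDimensional ℝ (TangentSpace I' p) := inferInstanceAs (FiniteDimensional ℝ E')
  exact sharp_unique (screenMetric_nondegenerate hS p) _ h

theorem screenMetric_sharp (hS : IsScreenDistribution g ι S) (p : M') (α : S p →ₗ[ℝ] ℝ)
    (z : S p) : screenMetric g ι S p (sharp (screenMetric g ι S p) α) z = α z := by
  have : FiniteDimensional ℝ (TangentSpace I' p) := inferInstanceAs (FiniteDimensional ℝ E')
  exact sharp_apply (screenMetric_nondegenerate hS p) _ z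

theorem inner_gradient (g : PseudoRiemannianMetric I M) (ψ : M → ℝ) (x : M)
    (w : TangentSpace I x) : g.inner x (gradient g ψ x) w = mvfderiv I ψ x w := by
  have : FiniteDimensional ℝ (TangentSpace I x) := inferInstanceAs (FiniteDimensional ℝ E)
  exact sharp_apply (g.bilin_nondegenerate x) _ w

/-- A screen distribution of a metric is one of each conformal metric. -/
theorem IsScreenDistribution.of_conformal {c : M → ℝ}
    (hc : ∀ (x : M) (v w : TangentSpace I x), g₂.inner x v w = Real.exp (c x) * g.inner x v w)
    (hS : IsScreenDistribution g ι S) : IsScreenDistribution g₂ ι S := by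
  refine ⟨hS.1, fun p => ?_⟩
  have h : radical g₂ I' ι p = radical g I' ι p := by
    ext v
    simp only [radical, LinearMap.mem_ker, LinearMap.ext_iff, LinearMap.zero_apply,
      inducedForm_apply, hc, mul_eq_zero, Real.exp_ne_zero, false_or]
  rw [h]
  exact hS.2 p

theorem isSWMTOn_screen [T2Space M] [I.Boundaryless] [I'.Boundaryless] {η : OneForm I M}
    {nabla : AffineConnection I M} (hSW : IsSWMT g η nabla) (hι : ContMDiff I' I ∞ ι)
    (hS : IsScreenDistribution g ι S) (hint : IsIntegrable S) :
    IsSWMTOn S (screenMetric g ι S) (screenOneForm η ι S) (screenConnection g nabla ι S) := by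
  refine ⟨fun p => ⟨screenMetric_symm p, screenMetric_nondegenerate hS p⟩,
    fun X Y Z hX hY hZ p => ?_⟩
  let B : S p := ⟨_, hint X Y hX hY p⟩
  have hsub : (screenConnection g nabla ι S X Y p - screenConnection g nabla ι S Y X p - B : S p) =
      ((screenConnection g nabla ι S X Y p : TangentSpace I' p)
        - screenConnection g nabla ι S Y X p - mlieBracket I' (fun q => (X q : TangentSpace I' q))
          (fun q => (Y q : TangentSpace I' q)) p) := rfl
  refine ⟨_, hsub, ?_⟩
  have hιp := hι.mdifferentiable (by simp) p
  have hXp := mdifferentiableAt_differential hι hX p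
  have hYp := mdifferentiableAt_differential hι hY p
  have hZp := mdifferentiableAt_differential hι hZ p
  have hXY := covDerivMetric_along g nabla hιp hYp hZp (X p)
  have hYX := covDerivMetric_along g nabla hιp hXp hZp (Y p)
  have hT := congrArg (fun w => g.inner (ι p) w (differential I I' ι p (Z p)))
    (covDerivAlong_sub_covDerivAlong nabla hι hX hY p)
  have hp := hSW.extend (ι p) (differential I I' ι p (X p)) (differential I I' ι p (Y p))
    (differential I I' ι p (Z p))
  have hD (X Y Z : Π p, S p) : screenMetric g ι S p (screenConnection g nabla ι S X Y p) (Z p) =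
      g.inner (ι p) (covDerivAlong nabla I' ι (fun q => differential I I' ι q (Y q)) p (X p))
        (differential I I' ι p (Z p)) := screenMetric_screenPart hS p _ _
  have hD' (X Y Z : Π p, S p) : screenMetric g ι S p (Z p) (screenConnection g nabla ι S X Y p) =
      g.inner (ι p) (differential I I' ι p (Z p))
        (covDerivAlong nabla I' ι (fun q => differential I I' ι q (Y q)) p (X p)) := by
    rw [screenMetric_symm, hD, g.symm]
  have hB : screenMetric g ι S p B (Z p) = g.inner (ι p)
      (differential I I' ι p (mlieBracket I' (fun q => (X q : TangentSpace I' q))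
        (fun q => (Y q : TangentSpace I' q)) p)) (differential I I' ι p (Z p)) := rfl
  have hη (X : Π p, S p) : screenOneForm η ι S p (X p) =
      η.toFun (ι p) (differential I I' ι p (X p)) := rfl
  simp only [map_sub, map_add, sub_apply, add_apply] at hT
  simp only [map_sub, LinearMap.sub_apply, hD, hD', hB, hη, screenMetric_apply]
  linear_combination hXY - hYX + hp + hT

theorem conformalProjectiveEquivalentOn_screen [T2Space M]
    {nabla nabla₂ : AffineConnection I M} (hι : ContMDiff I' I ∞ ι)
    (hS : IsScreenDistribution g ι S) (h : ConformalProjectiveEquivalent g nabla g₂ nabla₂) :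
    ConformalProjectiveEquivalentOn S
      (screenMetric g ι S) (screenConnection g nabla ι S)
      (screenMetric g₂ ι S) (screenConnection g₂ nabla₂ ι S) := by
  obtain ⟨φ, ψ, hφ, hψ, hg, hnabla⟩ := h
  have hS₂ : IsScreenDistribution g₂ ι S := hS.of_conformal (c := fun x => φ x + ψ x) hg
  have hmetric (p : M') (u v : S p) : screenMetric g₂ ι S p u v =
      Real.exp (φ (ι p) + ψ (ι p)) * screenMetric g ι S p u v := hg _ _ _
  refine ⟨φ ∘ ι, ψ ∘ ι, hφ.comp hι, hψ.comp hι, hmetric, fun X Y hX hY p => ?_⟩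
  have hιp := hι.mdifferentiable (by simp) p
  have hd {f : M → ℝ} (hf : ContMDiff I 𝓘(ℝ, ℝ) ∞ f) (v : TangentSpace I' p) :
      mvfderiv I' (f ∘ ι) p v = mvfderiv I f (ι p) (differential I I' ι p v) :=
    mvfderiv_comp_apply p (hf.mdifferentiable (by simp) (ι p)) hιp v
  have hcov := covDeriv_extend_of_conformalProjective hnabla (ι p)
    (differential I I' ι p (X p)) (differential I I' ι p (Y p))
  have hD : covDerivAlong nabla₂ I' ι (fun q => differential I I' ι q (Y q)) p (X p) =
      covDerivAlong nabla I' ι (fun q => differential I I' ι q (Y q)) p (X p)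
        + mvfderiv I φ (ι p) (differential I I' ι p (X p)) • differential I I' ι p (Y p)
        + mvfderiv I φ (ι p) (differential I I' ι p (Y p)) • differential I I' ι p (X p)
        - g.inner (ι p) (differential I I' ι p (X p)) (differential I I' ι p (Y p)) •
          gradient g ψ (ι p) := by
    unfold covDerivAlong
    rw [hcov]
    abel
  refine (eq_screenPart hS₂ p fun z => ?_).symm
  have h₁ : screenMetric g ι S p (screenConnection g nabla ι S X Y p) z =
      g.inner (ι p) (covDerivAlong nabla I' ι (fun q => differential I I' ι q (Y q)) p (X p))
        (differential I I' ι p z) := screenMetric_screenPart hS p _ _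
  have h₂ := hd hψ (z : TangentSpace I' p)
  rw [hD, hmetric, hg]
  congr 1
  simp only [map_add, map_sub, map_smul, LinearMap.add_apply, LinearMap.sub_apply,
    LinearMap.smul_apply, add_apply, sub_apply, smul_apply, h₁, screenMetric_sharp hS,
    inner_gradient, hd hφ, screenMetric_apply]
  rw [← h₂]
  rfl

end Screen

end SemiWeyl

end

theorem mainTheorem7 (n : ℕ)
    (M : Type*) [TopologicalSpace M] [T2Space M] [SecondCountableTopology M]
    [ChartedSpace (EuclideanSpace ℝ (Fin (n + 2))) M] [IsManifold (𝓡 (n + 2)) ∞ M]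
    (M' : Type*) [TopologicalSpace M'] [T2Space M'] [SecondCountableTopology M']
    [ChartedSpace (EuclideanSpace ℝ (Fin (n + 1))) M'] [IsManifold (𝓡 (n + 1)) ∞ M']
    (g g₂ : PseudoRiemannianMetric (𝓡 (n + 2)) M) (η : OneForm (𝓡 (n + 2)) M)
    (nabla nabla₂ : AffineConnection (𝓡 (n + 2)) M)
    [CovariantDerivative.ContMDiffCovariantDerivative nabla ∞] [CovariantDerivative.ContMDiffCovariantDerivative nabla₂ ∞]
    (hSW : IsSWMT g η nabla) (hSW₂ : IsSWMT g₂ η nabla₂)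
    (hequiv : ConformalProjectiveEquivalent g nabla g₂ nabla₂)
    (ι : M' → M) (hι : IsLightlike g (𝓡 (n + 1)) ι)
    (S : Π p : M', Submodule ℝ (TangentSpace (𝓡 (n + 1)) p))
    (hS : IsScreenDistribution g ι S) (hint : IsIntegrable S) :
    IsSWMTOn S (screenMetric g ι S) (screenOneForm η ι S) (screenConnection g nabla ι S) ∧
    IsSWMTOn S (screenMetric g₂ ι S) (screenOneForm η ι S) (screenConnection g₂ nabla₂ ι S) ∧
    ConformalProjectiveEquivalentOn S
      (screenMetric g ι S) (screenConnection g nabla ι S)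
      (screenMetric g₂ ι S) (screenConnection g₂ nabla₂ ι S) := by
  have hιs : ContMDiff (𝓡 (n + 1)) (𝓡 (n + 2)) ∞ ι := hι.1.contMDiff
  have hS₂ : IsScreenDistribution g₂ ι S := by
    obtain ⟨φ, ψ, -, -, hg, -⟩ := hequiv
    exact hS.of_conformal (c := fun x => φ x + ψ x) hg
  exact ⟨isSWMTOn_screen hSW hιs hS hint, isSWMTOn_screen hSW₂ hιs hS₂ hint,
    conformalProjectiveEquivalentOn_screen hιs hS hequiv⟩
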